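/- Let $q\ge 1$, $n\ge 2$ and $1\le k\le n$ be integers. On $n$ qudits $(\mathbb C^q)^{\otimes n}$, with the computational basis and a distinguished basis vector $|0\rangle\in\mathbb C^q$, let $U_{[j,j+1]}$, $1\le j\le n-1$, denote a unitary gate in $U(q^2)$ acting on the neighbouring qudits $j,j+1$ (and as the identity on the others), and consider the convolutional circuit $U_{[n-1,n]}\cdots U_{[2,3]}U_{[1,2]}$. All qudits except the last one, $n$, are idle after this circuit. The rewinding circuit therefore undoes, in reverse order, exactly the gates acting only on the qudits $1,\dots,n-1$, and applied to the initial state $|0\rangle^{\otimes n}$ the whole protocol produces $$|\psi_n\rangle = U_{[1,2]}^\dagger U_{[2,3]}^\dagger\cdots U_{[n-2,n-1]}^\dagger\;U_{[n-1,n]}U_{[n-2,n-1]}\cdots U_{[2,3]}U_{[1,2]}\,|0\rangle^{\otimes n}.$$ Let the $n-1$ gates be independent and distributed according to the Haar probability measure of $U(q^2)$. Then the fidelity $\langle\psi_n|\,\big((|0\rangle\langle 0|)^{\otimes k}\otimes I\big)\,|\psi_n\rangle$ of resetting the first $k$ qudits simultaneously, where $I$ is the identity on the last $n-k$ qudits,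 is an integrable function of the gates, and its average $F_{1\to k}$ is $$F_{1\to k} = 1-\left(\frac{q^2}{q^2+1}\right)^{n-k}\left(1-\frac{1}{q(q^2-q+1)}\left(1+\frac{(q-1)^2}{q}\left(\frac{q}{q^2+1}\right)^{k-2}\right)\right).$$ -/

import Mathlib

open MeasureTheory
open scoped Matrix

namespace RewindingProtocol

noncomputable section

/-- The group of two-qudit gates: unitary operators on `ℂ^q ⊗ ℂ^q`, written in the
computational basis `|a⟩ ⊗ |b⟩`, `(a, b) : Fin q × Fin q`. -/
abbrev TwoQuditUnitary (q : ℕ) := Matrix.unitaryGroup (Fin q × Fin q) ℂ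

instance instMeasurableSpaceTwoQuditUnitary (q : ℕ) : MeasurableSpace (TwoQuditUnitary q) :=
  borel _

instance instBorelSpaceTwoQuditUnitary (q : ℕ) : BorelSpace (TwoQuditUnitary q) := ⟨rfl⟩

theorem isCompact_twoQuditUnitary (q : ℕ) :
    IsCompact (Matrix.unitaryGroup (Fin q × Fin q) ℂ :
      Set (Matrix (Fin q × Fin q) (Fin q × Fin q) ℂ)) := by
  have hK : IsCompact (Set.univ.pi fun _ : Fin q × Fin q =>
      Set.univ.pi fun _ : Fin q × Fin q => Metric.closedBall (0 : ℂ) 1) :=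
    isCompact_univ_pi fun _ => isCompact_univ_pi fun _ => isCompact_closedBall _ _
  refine IsCompact.of_isClosed_subset hK ?_ ?_
  · exact isClosed_unitary
  · intro U hU i _ j _
    simpa using entry_norm_bound_of_unitary hU i j

instance instCompactSpaceTwoQuditUnitary (q : ℕ) : CompactSpace (TwoQuditUnitary q) :=
  isCompact_iff_compactSpace.mp (isCompact_twoQuditUnitary q)

/-- The Haar probability measure on the two-qudit unitary group `U(q²)`
(normalized so that the whole group has measure `1`). -/
def haarUnitary (q : ℕ) : Measure (TwoQuditUnitary q) :=
  Measure.haarMeasure ⊤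

/-- Computational basis labels of a system of `n` qudits of local dimension `q`. -/
abbrev Config (n q : ℕ) := Fin n → Fin q

/-- A two-qudit gate of an `n`-qudit circuit: it acts as `unitary` on the ordered pair of
distinct qudits `(fst, snd)`. -/
structure Gate (n q : ℕ) where
  fst : Fin n
  snd : Fin n
  fst_ne_snd : fst ≠ snd
  unitary : TwoQuditUnitary q

/-- The operator of a gate on the full `n`-qudit space: `unitary` on the two qudits it acts on,
tensored with the identity on all other qudits. -/
def Gate.toMatrix {n q : ℕ} (g : Gate n q) : Matrix (Config n q) (Config n q) ℂ :=
  fun x y =>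
    if ∀ l : Fin n, l ≠ g.fst → l ≠ g.snd → x l = y l then
      (g.unitary : Matrix (Fin q × Fin q) (Fin q × Fin q) ℂ)
        (x g.fst, x g.snd) (y g.fst, y g.snd)
    else 0

/-- The inverse gate `g†`, acting on the same two qudits. -/
def Gate.adjoint {n q : ℕ} (g : Gate n q) : Gate n q where
  fst := g.fst
  snd := g.snd
  fst_ne_snd := g.fst_ne_snd
  unitary := g.unitary⁻¹

/-- A circuit `(g₁, …, g_N)`, listed in the order in which the gates are applied. -/
abbrev Circuit (n q : ℕ) := List (Gate n q)

/-- The operator `U(C) = g_N ⋯ g₂ g₁` implemented by the circuit `C = (g₁, …, g_N)`. -/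
def Circuit.toMatrix {n q : ℕ} : Circuit n q → Matrix (Config n q) (Config n q) ℂ
  | [] => 1
  | g :: C => Circuit.toMatrix C * g.toMatrix

/-- The gates of `C` that act only on idle qudits, in their original order. -/
def idlePart {n q : ℕ} (idle : Finset (Fin n)) (C : Circuit n q) : Circuit n q :=
  C.filter fun g => decide (g.fst ∈ idle ∧ g.snd ∈ idle)

/-- The rewinding circuit `(g_N†, …, g₁†)` of the subcircuit `(g₁, …, g_N)` of `C` that consists
of the gates acting only on idle qudits. -/
def rewindingCircuit {n q : ℕ} (idle : Finset (Fin n)) (C : Circuit n q) : Circuit n q :=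
  (idlePart idle C).reverse.map Gate.adjoint

/-- The initial state `|0⟩^{⊗ n}`. -/
def zeroState (n q : ℕ) [NeZero q] : Config n q → ℂ :=
  Pi.single 0 1

/-- The state `|ψ_n⟩ = R U(C) |0 ⋯ 0⟩` after the circuit `C` and then its rewinding circuit `R`
have been applied. -/
def rewoundState {n q : ℕ} [NeZero q] (idle : Finset (Fin n)) (C : Circuit n q) :
    Config n q → ℂ :=
  (Circuit.toMatrix (rewindingCircuit idle C) * Circuit.toMatrix C) *ᵥ zeroState n q

/-- The projector `|0 ⋯ 0⟩⟨0 ⋯ 0| ⊗ I`, where the first factor acts on the first `k` of the `n`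
qudits and the identity on the others. -/
def firstQuditsProjector (n q k : ℕ) [NeZero q] : Matrix (Config n q) (Config n q) ℂ :=
  Matrix.diagonal fun x => if ∀ i : Fin n, i.val < k → x i = 0 then 1 else 0

/-- The fidelity `⟨ψ| (|0 ⋯ 0⟩⟨0 ⋯ 0| ⊗ I) |ψ⟩` of resetting the first `k` qudits. -/
def resetFidelity {n q : ℕ} [NeZero q] (k : ℕ) (ψ : Config n q → ℂ) : ℂ :=
  star ψ ⬝ᵥ (firstQuditsProjector n q k *ᵥ ψ)

/-- The convolutional circuit `U_{[n-1,n]} ⋯ U_{[2,3]} U_{[1,2]}` on `n` qudits with two-qudit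
gates: the `j`-th gate acts on the neighbouring qudits `j` and `j + 1`, and the gates are applied
in increasing order of `j` (qudits and gates are numbered from `0` here). -/
def convolutionalCircuit {n q : ℕ} (U : Fin (n - 1) → TwoQuditUnitary q) : Circuit n q :=
  List.ofFn fun j : Fin (n - 1) =>
    { fst := ⟨j.val, by omega⟩
      snd := ⟨j.val + 1, by omega⟩
      fst_ne_snd := by simp
      unitary := U j }

/-- The idle qudits after the convolutional circuit: the active window then moves on from the last
qudit, so all qudits but the last one are idle. -/
def convolutionalIdle (n : ℕ) : Finset (Fin n) :=
  Finset.univ.filter fun i => i.val + 1 < n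

/-- The fidelity of resetting the first `k` qudits by rewinding the convolutional circuit with
gates `U`. -/
def convolutionalFidelity {n q : ℕ} [NeZero q] (k : ℕ) (U : Fin (n - 1) → TwoQuditUnitary q) : ℂ :=
  resetFidelity k (rewoundState (convolutionalIdle n) (convolutionalCircuit U))

/-- The law of `n - 1` independent Haar-random two-qudit gates. -/
def gateMeasure (n q : ℕ) : Measure (Fin (n - 1) → TwoQuditUnitary q) :=
  Measure.pi fun _ => haarUnitary q

/-- The averaged fidelity `F_{1→k}` of resetting the first `k` qudits of the noiseless
convolutional circuit on `n` qudits. -/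
def averagedFidelity (n q k : ℕ) [NeZero q] : ℂ :=
  ∫ U, convolutionalFidelity (n := n) (q := q) k U ∂(gateMeasure n q)

end

end RewindingProtocol

namespace RewindingProtocol

/-! ### Haar measure on the two-qudit unitary group -/

section Haar

variable {q : ℕ}

/-! Let `P` be the product of the first `n - 2` gates and `g` the last gate. The rewinding circuit
is `P†`, so the final state has amplitude `⟨P y| g |P 0⟩` at the basis state `y`, and the fidelity
sums the squared moduli over the `y` that vanish on the first `k` qudits. Averaging over `g` needs
only first-order moments and gives `q⁻²` times the overlap `⟨P y ⊗ P 0| S |P y ⊗ P 0⟩`, where `S`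
swaps the first `n - 2` qudits of two copies (`integral_normSq_gate`, `averagedFidelity_eq_sum`).

The other gates are averaged from the last to the first. Each one straddles the edge of the swapped
block, and its twirl is `q / (q² + 1)` times the sum of two terms: the block shortened by one qudit
and the block extended by one (`meanSwapKernel_eq`, `integral_swapOverlap_gate`). The shortened
block is the same problem with one gate fewer. The extended block contains every qudit touched by
the remaining gates; these commute with the swap and cancel, leaving the indicator that `y` vanishes
on the block. This is the recursion `meanOverlap_succ`.

Summed over `y` it becomes a scalar linear recurrence with source `q ^ (n - max k (m + 2))`:
constant while `m + 2 ≤ k`, geometric afterwards. The two regimes are solved in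
`sumMeanOverlap_of_lt` and `sumMeanOverlap_add`.

The twirl is computed without representation theory: right invariance is tested only on phases,
permutations and one reflection, and two traces fix the remaining constants. -/

instance instSecondCountableTopologyTwoQuditUnitary (q : ℕ) :
    SecondCountableTopology (TwoQuditUnitary q) := by
  have : SecondCountableTopology (Matrix (Fin q × Fin q) (Fin q × Fin q) ℂ) :=
    inferInstanceAs (SecondCountableTopology (Fin q × Fin q → Fin q × Fin q → ℂ))
  exact Topology.IsEmbedding.subtypeVal.secondCountableTopology

instance instIsHaarMeasureHaarUnitary (q : ℕ) : (haarUnitary q).IsHaarMeasure := by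
  unfold haarUnitary; infer_instance

instance instIsProbabilityMeasureHaarUnitary (q : ℕ) : IsProbabilityMeasure (haarUnitary q) :=
  ⟨by simpa [haarUnitary] using
    Measure.haarMeasure_self (K₀ := (⊤ : TopologicalSpace.PositiveCompacts (TwoQuditUnitary q)))⟩

/-- A right translate of the left Haar measure is again a left-invariant probability measure, so
uniqueness applies. All moment computations multiply the gate on the right. -/
instance instIsMulRightInvariantHaarUnitary (q : ℕ) : (haarUnitary q).IsMulRightInvariant where
  map_mul_right_eq_self V := by
    have : IsProbabilityMeasure ((haarUnitary q).map (· * V)) :=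
      Measure.isProbabilityMeasure_map (measurable_mul_const V).aemeasurable
    exact Measure.isHaarMeasure_eq_of_isProbabilityMeasure _ _

theorem continuous_entry (a b : Fin q × Fin q) :
    Continuous fun U : TwoQuditUnitary q => U.1 a b :=
  continuous_subtype_val.matrix_elem a b

theorem integrable_haarUnitary {f : TwoQuditUnitary q → ℂ} (hf : Continuous f) :
    Integrable f (haarUnitary q) :=
  hf.integrable_of_hasCompactSupport (HasCompactSupport.of_compactSpace f)

theorem sum_mul_star_entry (U : TwoQuditUnitary q) (s t : Fin q × Fin q) :
    ∑ p, U.1 s p * star (U.1 t p) = if s = t then 1 else 0 := by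
  have h := congrFun (congrFun (Matrix.mem_unitaryGroup_iff.mp U.2) s) t
  simpa [Matrix.mul_apply, Matrix.one_apply] using h

theorem sum_star_mul_entry (U : TwoQuditUnitary q) (p r : Fin q × Fin q) :
    ∑ s, star (U.1 s p) * U.1 s r = if p = r then 1 else 0 := by
  have h := congrFun (congrFun (Matrix.mem_unitaryGroup_iff'.mp U.2) p) r
  simpa [Matrix.mul_apply, Matrix.one_apply] using h

/-- The gate that multiplies the basis vector `|a⟩` by the phase `i`. -/
noncomputable def phaseGate (a : Fin q × Fin q) : TwoQuditUnitary q :=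
  ⟨Matrix.diagonal fun x => if x = a then Complex.I else 1, by
    rw [Matrix.mem_unitaryGroup_iff, Matrix.star_eq_conjTranspose, Matrix.diagonal_conjTranspose,
      Matrix.diagonal_mul_diagonal, ← Matrix.diagonal_one]
    congr 1
    ext x
    by_cases h : x = a <;> simp [h]⟩

/-- The gate that permutes the computational basis. -/
noncomputable def permGate (σ : Equiv.Perm (Fin q × Fin q)) : TwoQuditUnitary q :=
  ⟨σ⁻¹.permMatrix ℂ, by
    rw [Matrix.mem_unitaryGroup_iff, Matrix.star_eq_conjTranspose, Matrix.conjTranspose_permMatrix,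
      ← Matrix.permMatrix_mul]
    simp⟩

/-- The reflection in the hyperplane orthogonal to `|a⟩ + 2 |b⟩`. -/
noncomputable def reflectionGate {a b : Fin q × Fin q} (hab : a ≠ b) : TwoQuditUnitary q :=
  ⟨1 - (2 / 5 : ℂ) • Matrix.vecMulVec (Pi.single a 1 + Pi.single b 2)
      (Pi.single a 1 + Pi.single b 2), by
    have hv : star (Pi.single a 1 + Pi.single b 2 : Fin q × Fin q → ℂ)
        = Pi.single a 1 + Pi.single b 2 := by
      rw [star_add, Pi.star_single, Pi.star_single, star_one, star_ofNat]
    have hvv : (Pi.single a 1 + Pi.single b 2 : Fin q × Fin q → ℂ) ⬝ᵥ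
        (Pi.single a 1 + Pi.single b 2) = 5 := by
      rw [add_dotProduct, single_dotProduct, single_dotProduct, Pi.add_apply, Pi.add_apply,
        Pi.single_eq_same, Pi.single_eq_same, Pi.single_eq_of_ne hab, Pi.single_eq_of_ne hab.symm]
      norm_num
    rw [Matrix.mem_unitaryGroup_iff, Matrix.star_eq_conjTranspose, Matrix.conjTranspose_sub,
      Matrix.conjTranspose_smul, Matrix.conjTranspose_vecMulVec, hv]
    simp only [Matrix.conjTranspose_one, star_div₀, star_ofNat, sub_mul, mul_sub, one_mul, mul_one,
      smul_mul_assoc, mul_smul_comm, Matrix.vecMulVec_mul_vecMulVec, hvv]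
    rw [Matrix.vecMulVec_smul]
    module⟩

theorem mul_phaseGate_entry (U : TwoQuditUnitary q) (a s p : Fin q × Fin q) :
    (U * phaseGate a).1 s p = U.1 s p * if p = a then Complex.I else 1 := by
  simp [phaseGate]

theorem mul_permGate_entry (U : TwoQuditUnitary q) (σ : Equiv.Perm (Fin q × Fin q))
    (s p : Fin q × Fin q) : (U * permGate σ).1 s p = U.1 s (σ p) := by
  simp [permGate, Matrix.mul_apply, Equiv.Perm.permMatrix, PEquiv.toMatrix_apply,
    Equiv.symm_apply_eq]

theorem mul_reflectionGate_entry (U : TwoQuditUnitary q) {a b : Fin q × Fin q} (hab : a ≠ b)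
    (s : Fin q × Fin q) :
    (U * reflectionGate hab).1 s a = 3 / 5 * U.1 s a + -4 / 5 * U.1 s b := by
  have h : ∀ x, (reflectionGate hab).1 x a =
      (if x = a then 3 / 5 else 0) + (if x = b then -4 / 5 else 0) := by
    intro x
    by_cases hxa : x = a
    · subst hxa
      simp [reflectionGate, Matrix.vecMulVec_apply, hab]
      norm_num
    · by_cases hxb : x = b
      · subst hxb
        simp [reflectionGate, Matrix.vecMulVec_apply, hab, hab.symm]
        norm_num
      · simp [reflectionGate, Matrix.vecMulVec_apply, hab, hxa, hxb]
  have : (U * reflectionGate hab).1 s a = ∑ x, U.1 s x * (reflectionGate hab).1 x a := by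
    simp [Matrix.mul_apply]
  rw [this]
  simp only [h, mul_add, Finset.sum_add_distrib]
  simp
  ring

/-- The first-order Haar moments of a two-qudit gate. -/
theorem integral_entry_mul_star_entry [NeZero q] (s p s' p' : Fin q × Fin q) :
    ∫ U : TwoQuditUnitary q, U.1 s p * star (U.1 s' p') ∂(haarUnitary q) =
      if s = s' ∧ p = p' then ((q : ℂ) ^ 2)⁻¹ else 0 := by
  by_cases hp : p = p'
  · subst hp
    have hconst : ∀ r, ∫ U : TwoQuditUnitary q, U.1 s r * star (U.1 s' r) ∂(haarUnitary q) =
        ∫ U : TwoQuditUnitary q, U.1 s p * star (U.1 s' p) ∂(haarUnitary q) := by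
      -- Permuting columns makes all `q²` values equal; their sum is an entry of `U U†`.
      intro r
      rw [← integral_mul_right_eq_self _ (permGate (Equiv.swap r p))]
      simp only [mul_permGate_entry, Equiv.swap_apply_left]
    have hsum : ∑ r : Fin q × Fin q,
        ∫ U : TwoQuditUnitary q, U.1 s r * star (U.1 s' r) ∂(haarUnitary q) =
          if s = s' then 1 else 0 := by
      rw [← integral_finsetSum]
      · simp only [sum_mul_star_entry]
        simp
      · intro r _
        exact integrable_haarUnitary ((continuous_entry s r).mul (continuous_entry s' r).star)
    simp only [hconst, Finset.sum_const, Finset.card_univ, Fintype.card_prod, Fintype.card_fin,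
      nsmul_eq_mul] at hsum
    have hq : (q : ℂ) ≠ 0 := NeZero.ne _
    have : (q : ℂ) ^ 2 * ∫ U : TwoQuditUnitary q, U.1 s p * star (U.1 s' p) ∂(haarUnitary q) =
        if s = s' then 1 else 0 := by
      rw [← hsum]; push_cast; ring
    rw [← eq_inv_mul_iff_mul_eq₀ (pow_ne_zero 2 hq)] at this
    rw [this]
    by_cases h : s = s' <;> simp [h]
  · have h := integral_mul_right_eq_self (μ := haarUnitary q)
      (fun U : TwoQuditUnitary q => U.1 s p * star (U.1 s' p')) (phaseGate p)
    simp only [mul_phaseGate_entry, if_neg (Ne.symm hp), if_true, mul_one] at h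
    rw [if_neg (fun h => hp h.2)]
    have h2 : ∫ U : TwoQuditUnitary q, U.1 s p * Complex.I * star (U.1 s' p') ∂(haarUnitary q) =
        Complex.I * ∫ U : TwoQuditUnitary q, U.1 s p * star (U.1 s' p') ∂(haarUnitary q) := by
      rw [← integral_const_mul]
      congr 1; ext U; ring
    rw [h2] at h
    have h3 : (Complex.I - 1) *
        ∫ U : TwoQuditUnitary q, U.1 s p * star (U.1 s' p') ∂(haarUnitary q) = 0 := by
      rw [sub_mul, h]; ring
    refine (mul_eq_zero.mp h3).resolve_left fun h4 => ?_
    simpa using congrArg Complex.re h4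

end Haar
end RewindingProtocol

namespace RewindingProtocol

/-! ### The Haar twirl of the swap of the first qudits of two copies -/

section Twirl

variable {q : ℕ}

/-- The matrix element `⟨p, p'| (U ⊗ U)† S (U ⊗ U) |r, r'⟩`, where `S` swaps the first qudits of
the two copies. -/
noncomputable def swapKernel (U : TwoQuditUnitary q) (p p' r r' : Fin q × Fin q) : ℂ :=
  ∑ s : Fin q × Fin q, ∑ s' : Fin q × Fin q,
    star (U.1 s p) * star (U.1 s' p') * (U.1 (s'.1, s.2) r * U.1 (s.1, s'.2) r')

theorem continuous_swapKernel (p p' r r' : Fin q × Fin q) :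
    Continuous fun U : TwoQuditUnitary q => swapKernel U p p' r r' := by
  unfold swapKernel
  refine continuous_finsetSum _ fun s _ => continuous_finsetSum _ fun s' _ => ?_
  exact ((continuous_entry s p).star.mul (continuous_entry s' p').star).mul
    ((continuous_entry _ r).mul (continuous_entry _ r'))

/-- The Haar average of `swapKernel`. -/
noncomputable def meanSwapKernel (p p' r r' : Fin q × Fin q) : ℂ :=
  ∫ U : TwoQuditUnitary q, swapKernel U p p' r r' ∂(haarUnitary q)

theorem meanSwapKernel_perm (σ : Equiv.Perm (Fin q × Fin q)) (p p' r r' : Fin q × Fin q) :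
    meanSwapKernel (σ p) (σ p') (σ r) (σ r') = meanSwapKernel p p' r r' := by
  unfold meanSwapKernel
  conv_rhs => rw [← integral_mul_right_eq_self _ (permGate σ)]
  simp only [swapKernel, mul_permGate_entry]

theorem meanSwapKernel_phase (a p p' r r' : Fin q × Fin q) :
    meanSwapKernel p p' r r' =
      (star (if p = a then Complex.I else 1) * star (if p' = a then Complex.I else 1) *
        ((if r = a then Complex.I else 1) * (if r' = a then Complex.I else 1))) *
        meanSwapKernel p p' r r' := by
  unfold meanSwapKernel
  conv_lhs => rw [← integral_mul_right_eq_self _ (phaseGate a)]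
  rw [← integral_const_mul]
  congr 1
  ext U
  simp only [swapKernel, mul_phaseGate_entry, Finset.mul_sum, star_mul']
  refine Finset.sum_congr rfl fun s _ => Finset.sum_congr rfl fun s' _ => ?_
  ring

/-- A phase on a suitably chosen basis vector multiplies the element by `-i` or `-1`. The phase `i`
is needed: `-1` would not exclude `p = p' ≠ r = r'`. -/
theorem meanSwapKernel_eq_zero {p p' r r' : Fin q × Fin q} (h₁ : ¬(p = r ∧ p' = r'))
    (h₂ : ¬(p = r' ∧ p' = r)) : meanSwapKernel p p' r r' = 0 := by
  have key : ∀ z : ℂ, meanSwapKernel p p' r r' = z * meanSwapKernel p p' r r' → z ≠ 1 →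
      meanSwapKernel p p' r r' = 0 := by
    intro z hz h1
    have h : (z - 1) * meanSwapKernel p p' r r' = 0 := by rw [sub_mul, ← hz]; ring
    exact (mul_eq_zero.mp h).resolve_left (sub_ne_zero.mpr h1)
  have hI : -Complex.I ≠ 1 := fun h => by simpa using congrArg Complex.re h
  have hII : (-1 : ℂ) ≠ 1 := by norm_num
  by_cases hpr : p = r
  · have h : ¬ r' = p' := fun h => h₁ ⟨hpr, h.symm⟩
    refine key _ (meanSwapKernel_phase p' p p' r r') ?_
    subst hpr
    by_cases hpp : p = p' <;> simp [hpp, h, hI]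
  · by_cases hpr' : p = r'
    · have h : ¬ r = p' := fun h => h₂ ⟨hpr', h.symm⟩
      refine key _ (meanSwapKernel_phase p' p p' r r') ?_
      subst hpr'
      by_cases hpp : p = p' <;> simp [hpp, h, hI]
    · refine key _ (meanSwapKernel_phase p p p' r r') ?_
      by_cases hpp : p' = p <;> simp [hpp, Ne.symm hpr, Ne.symm hpr', hI, hII]

/-- Phases and permutations leave three constants free. Invariance under a unitary that mixes two
basis vectors relates them; the reflection does so with the rational coefficients `3/5` and `-4/5`.
-/
theorem meanSwapKernel_reflection {a b : Fin q × Fin q} (hab : a ≠ b) :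
    meanSwapKernel a a a a = meanSwapKernel a b a b + meanSwapKernel a b b a := by
  let c : Bool → Fin q × Fin q := fun i => cond i a b
  let w : Bool → ℂ := fun i => cond i (3 / 5) (-4 / 5)
  have hw : ∀ i, star (w i) = w i := by intro i; cases i <;> simp [w]
  have hent : ∀ (U : TwoQuditUnitary q) s,
      (U * reflectionGate hab).1 s a = ∑ i, w i * U.1 s (c i) := by
    intro U s
    rw [mul_reflectionGate_entry, Fintype.sum_bool]
    rfl
  -- Each of the four columns is independently `a` or `b`, encoded by a Boolean; the weights are
  -- real, so conjugation does not affect them.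
  have hexp : ∀ U : TwoQuditUnitary q, swapKernel (U * reflectionGate hab) a a a a =
      ∑ t : Bool × Bool × Bool × Bool, w t.1 * w t.2.1 * w t.2.2.1 * w t.2.2.2 *
        swapKernel U (c t.1) (c t.2.1) (c t.2.2.1) (c t.2.2.2) := by
    intro U
    simp only [swapKernel, hent, Finset.mul_sum]
    rw [Finset.sum_comm]
    simp_rw [Finset.sum_comm (s := (Finset.univ : Finset (Bool × Bool × Bool × Bool)))]
    rw [Finset.sum_comm]
    refine Finset.sum_congr rfl fun s _ => Finset.sum_congr rfl fun s' _ => ?_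
    simp only [Fintype.sum_prod_type, star_mul', hw, Fintype.sum_bool, star_add]
    ring
  have hmean : meanSwapKernel a a a a =
      ∑ t : Bool × Bool × Bool × Bool, w t.1 * w t.2.1 * w t.2.2.1 * w t.2.2.2 *
        meanSwapKernel (c t.1) (c t.2.1) (c t.2.2.1) (c t.2.2.2) := by
    conv_lhs => rw [meanSwapKernel, ← integral_mul_right_eq_self _ (reflectionGate hab)]
    simp only [hexp]
    rw [integral_finsetSum]
    · simp only [integral_const_mul, meanSwapKernel]
    · intro t _
      exact (integrable_haarUnitary (continuous_swapKernel _ _ _ _)).const_mul _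
  have haa : meanSwapKernel b b b b = meanSwapKernel a a a a := by
    simpa using meanSwapKernel_perm (Equiv.swap a b) a a a a
  have hba : meanSwapKernel b a b a = meanSwapKernel a b a b := by
    simpa using meanSwapKernel_perm (Equiv.swap a b) a b a b
  have hba' : meanSwapKernel b a a b = meanSwapKernel a b b a := by
    simpa using meanSwapKernel_perm (Equiv.swap a b) a b b a
  have hz : ∀ p p' r r' : Fin q × Fin q, ¬(p = r ∧ p' = r') → ¬(p = r' ∧ p' = r) →
      meanSwapKernel p p' r r' = 0 := fun _ _ _ _ => meanSwapKernel_eq_zero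
  simp only [Fintype.sum_prod_type, Fintype.sum_bool, c, w, cond_true, cond_false] at hmean
  rw [hz a a a b, hz a a b a, hz a a b b, hz a b a a, hz a b b b, hz b a a a, hz b a b b,
    hz b b a a, hz b b a b, hz b b b a, haa, hba, hba'] at hmean
  -- The surviving terms read `A = (337/625) A + (288/625) (B + C)`, since `81 + 256 = 337` and `2 *
  -- 9 * 16 = 288`.
  · linear_combination (625 / 288 : ℂ) * hmean
  all_goals simp [hab, hab.symm]

theorem exists_perm_apply_eq {ι : Type*} [DecidableEq ι] {a b c d : ι} (hab : a ≠ b) (hcd : c ≠ d) :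
    ∃ σ : Equiv.Perm ι, σ a = c ∧ σ b = d := by
  refine ⟨Equiv.swap (Equiv.swap a c b) d * Equiv.swap a c, ?_, by simp⟩
  rw [Equiv.Perm.mul_apply, Equiv.swap_apply_left]
  refine Equiv.swap_apply_of_ne_of_ne (fun h => hab ?_) hcd
  rw [eq_comm, Equiv.swap_apply_eq_iff, Equiv.swap_apply_right] at h
  exact h.symm

/-- The averaged operator commutes with every `V ⊗ V`, so it is a combination of the identity and
the full swap. Double transitivity of permutations reduces each nonzero off-diagonal type to one
representative pair. -/
theorem exists_meanSwapKernel_eq [NeZero q] : ∃ β γ : ℂ, ∀ p p' r r' : Fin q × Fin q,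
    meanSwapKernel p p' r r' =
      β * (if p = r ∧ p' = r' then 1 else 0) + γ * (if p = r' ∧ p' = r then 1 else 0) := by
  by_cases hs : ∃ a b : Fin q × Fin q, a ≠ b
  · obtain ⟨a, b, hab⟩ := hs
    refine ⟨meanSwapKernel a b a b, meanSwapKernel a b b a, fun p p' r r' => ?_⟩
    by_cases h₁ : p = r ∧ p' = r'
    · obtain ⟨rfl, rfl⟩ := h₁
      by_cases hp : p = p'
      · subst hp
        have := meanSwapKernel_perm (Equiv.swap a p) a a a a
        rw [Equiv.swap_apply_left] at this
        simp [this, meanSwapKernel_reflection hab]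
      · obtain ⟨σ, rfl, rfl⟩ := exists_perm_apply_eq hab hp
        rw [meanSwapKernel_perm]
        simp [hab]
    · by_cases h₂ : p = r' ∧ p' = r
      · obtain ⟨rfl, rfl⟩ := h₂
        have hp : p ≠ p' := fun h => h₁ ⟨h, h.symm⟩
        obtain ⟨σ, rfl, rfl⟩ := exists_perm_apply_eq hab hp
        rw [meanSwapKernel_perm]
        simp [hab]
      · rw [meanSwapKernel_eq_zero h₁ h₂]
        simp [h₁, h₂]
  · push Not at hs
    refine ⟨meanSwapKernel (0 : Fin q × Fin q) 0 0 0, 0, fun p p' r r' => ?_⟩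
    rw [hs p 0, hs p' 0, hs r 0, hs r' 0]
    simp

/-! ### Traces that fix the twirl coefficients -/

theorem sum_star_star_mul_entries (U : TwoQuditUnitary q) (s s' t t' : Fin q × Fin q) :
    ∑ p : Fin q × Fin q, ∑ p' : Fin q × Fin q,
      star (U.1 s p) * star (U.1 s' p') * (U.1 t p * U.1 t' p') =
        if t = s ∧ t' = s' then 1 else 0 := by
  have h := congrArg₂ (· * ·) (sum_mul_star_entry U t s) (sum_mul_star_entry U t' s')
  simp only [Finset.sum_mul_sum] at h
  rw [ite_and, show (if t = s then (if t' = s' then (1 : ℂ) else 0) else 0) =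
    (if t = s then 1 else 0) * (if t' = s' then 1 else 0) by split_ifs <;> simp, ← h]
  refine Finset.sum_congr rfl fun p _ => Finset.sum_congr rfl fun p' _ => ?_
  ring

theorem sum_sum_comm_sum_sum {α β : Type*} [Fintype α] [Fintype β] {R : Type*} [AddCommMonoid R]
    (f : α → α → β → β → R) :
    ∑ a, ∑ a', ∑ b, ∑ b', f a a' b b' = ∑ b, ∑ b', ∑ a, ∑ a', f a a' b b' := by
  rw [← Fintype.sum_prod_type' fun a a' => ∑ b, ∑ b', f a a' b b']
  simp_rw [← fun a a' => Fintype.sum_prod_type' fun b b' => f a a' b b',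
    ← fun b b' => Fintype.sum_prod_type' fun a a' => f a a' b b']
  rw [← Fintype.sum_prod_type' fun b b' => ∑ x : α × α, f x.1 x.2 b b']
  exact Finset.sum_comm

/-- By cyclicity this is the trace of `S`: a swap of two qudits has trace `q`, the two untouched
qudits contribute `q²`. -/
theorem sum_swapKernel_diag (U : TwoQuditUnitary q) :
    ∑ p : Fin q × Fin q, ∑ p' : Fin q × Fin q, swapKernel U p p' p p' = (q : ℂ) ^ 3 := by
  simp only [swapKernel]
  rw [sum_sum_comm_sum_sum]
  simp only [sum_star_star_mul_entries]
  have h : ∀ s s' : Fin q × Fin q,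
      (if (s'.1, s.2) = s ∧ (s.1, s'.2) = s' then (1 : ℂ) else 0) = if s.1 = s'.1 then 1 else 0 := by
    rintro ⟨a, b⟩ ⟨c, d⟩
    simp [eq_comm]
  simp only [h]
  have h' : ∀ s : Fin q × Fin q,
      (∑ s' : Fin q × Fin q, if s.1 = s'.1 then (1 : ℂ) else 0) = q := fun s =>
    (Fintype.sum_prod_type' fun a b : Fin q => if s.1 = a then (1 : ℂ) else 0).trans (by simp)
  simp only [h', Finset.sum_const, Finset.card_univ, Fintype.card_prod, Fintype.card_fin,
    nsmul_eq_mul]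
  push_cast
  ring

/-- The trace against the full swap, which commutes with `U ⊗ U`; `S` times the full swap is the
swap of the second qudits. -/
theorem sum_swapKernel_antidiag (U : TwoQuditUnitary q) :
    ∑ p : Fin q × Fin q, ∑ p' : Fin q × Fin q, swapKernel U p p' p' p = (q : ℂ) ^ 3 := by
  simp only [swapKernel]
  rw [sum_sum_comm_sum_sum]
  simp only [mul_comm (U.1 _ _) (U.1 _ _), sum_star_star_mul_entries]
  have h : ∀ s s' : Fin q × Fin q,
      (if (s.1, s'.2) = s ∧ (s'.1, s.2) = s' then (1 : ℂ) else 0) = if s.2 = s'.2 then 1 else 0 := by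
    rintro ⟨a, b⟩ ⟨c, d⟩
    simp [eq_comm]
  simp only [h]
  have h' : ∀ s : Fin q × Fin q,
      (∑ s' : Fin q × Fin q, if s.2 = s'.2 then (1 : ℂ) else 0) = q := fun s =>
    (Fintype.sum_prod_type' fun a b : Fin q => if s.2 = b then (1 : ℂ) else 0).trans (by simp)
  simp only [h', Finset.sum_const, Finset.card_univ, Fintype.card_prod, Fintype.card_fin,
    nsmul_eq_mul]
  push_cast
  ring

theorem sum_sum_meanSwapKernel {c : ℂ}
    {f g : Fin q × Fin q → Fin q × Fin q → Fin q × Fin q}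
    (h : ∀ U : TwoQuditUnitary q, ∑ p, ∑ p', swapKernel U p p' (f p p') (g p p') = c) :
    ∑ p, ∑ p', meanSwapKernel p p' (f p p') (g p p') = c := by
  have hi : ∀ p p' r r' : Fin q × Fin q,
      Integrable (fun U => swapKernel U p p' r r') (haarUnitary q) :=
    fun p p' r r' => integrable_haarUnitary (continuous_swapKernel p p' r r')
  simp only [meanSwapKernel]
  simp_rw [← integral_finsetSum Finset.univ fun p' _ => hi _ p' (f _ p') (g _ p')]
  rw [← integral_finsetSum _ fun p _ => integrable_finsetSum _ fun p' _ => hi p p' _ _]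
  simp [h]

/-- The swap of the first qudits of two copies of a two-qudit system is twirled into
`q / (q² + 1)` times the sum of the identity and the swap of both qudits. -/
theorem meanSwapKernel_eq [NeZero q] (p p' r r' : Fin q × Fin q) :
    meanSwapKernel p p' r r' = (q : ℂ) / ((q : ℂ) ^ 2 + 1) *
      ((if p = r ∧ p' = r' then 1 else 0) + (if p = r' ∧ p' = r then 1 else 0)) := by
  obtain ⟨β, γ, h⟩ := exists_meanSwapKernel_eq (q := q)
  have h1 := sum_sum_meanSwapKernel (f := fun p _ => p) (g := fun _ p' => p')
    (sum_swapKernel_diag (q := q))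
  have h2 := sum_sum_meanSwapKernel (f := fun _ p' => p') (g := fun p _ => p)
    (sum_swapKernel_antidiag (q := q))
  have hs : ∀ p : Fin q × Fin q,
      (∑ p' : Fin q × Fin q, if p = p' ∧ p' = p then (1 : ℂ) else 0) = 1 := by
    intro p
    rw [Finset.sum_eq_single p] <;> simp +contextual [eq_comm]
  simp only [h, and_self, if_true, Finset.sum_add_distrib, ← Finset.mul_sum, hs, Finset.sum_const,
    Finset.card_univ, Fintype.card_prod, Fintype.card_fin, nsmul_eq_mul, mul_one] at h1 h2
  push_cast at h1 h2
  have hq : (q : ℂ) ≠ 0 := NeZero.ne _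
  have hq1 : (q : ℂ) ^ 2 + 1 ≠ 0 := by exact_mod_cast Nat.succ_ne_zero (q ^ 2)
  have hsum : β + γ = 2 * ((q : ℂ) / ((q : ℂ) ^ 2 + 1)) := by
    field_simp
    have h3 : (q : ℂ) ^ 2 * ((β + γ) * ((q : ℂ) ^ 2 + 1)) = (q : ℂ) ^ 2 * (2 * q) := by
      linear_combination h1 + h2
    exact mul_left_cancel₀ (pow_ne_zero 2 hq) h3
  rw [h]
  -- For `q = 1` the two trace equations coincide, but identity and swap coincide too and only `β +
  -- γ` matters. Otherwise their difference gives `β = γ`.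
  by_cases hs : Subsingleton (Fin q × Fin q)
  · rw [Subsingleton.elim p r, Subsingleton.elim p' r, Subsingleton.elim r' r]
    simp only [and_self, if_true]
    linear_combination hsum
  · have hqq : (q : ℂ) ^ 2 - 1 ≠ 0 := by
      intro h4
      have h5 : q ^ 2 = 1 := by exact_mod_cast sub_eq_zero.mp h4
      apply hs
      rw [← Fintype.card_le_one_iff_subsingleton]
      simp [← sq, h5]
    have hdiff : β = γ := by
      have h3 : (q : ℂ) ^ 2 * ((q : ℂ) ^ 2 - 1) * (β - γ) = 0 := by linear_combination h1 - h2
      exact sub_eq_zero.mp ((mul_eq_zero.mp h3).resolve_left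
        (mul_ne_zero (pow_ne_zero 2 hq) hqq))
    subst hdiff
    have : β = (q : ℂ) / ((q : ℂ) ^ 2 + 1) := by linear_combination hsum / 2
    rw [this]
    ring

end Twirl
end RewindingProtocol

namespace RewindingProtocol

/-! ### Swap overlaps of two states and the action of a gate on them -/

section Overlap

variable {n q : ℕ}

/-- The configuration obtained from `x` by setting the qudits `i, j` to the values `s`. -/
def setPair (i j : Fin n) (x : Config n q) (s : Fin q × Fin q) : Config n q :=
  Function.update (Function.update x i s.1) j s.2

section setPair

variable {i j : Fin n} (x x' : Config n q) (s s' : Fin q × Fin q)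

theorem setPair_fst (hij : i ≠ j) : setPair i j x s i = s.1 := by
  simp [setPair, hij]

theorem setPair_snd : setPair i j x s j = s.2 := by
  simp [setPair]

theorem setPair_of_ne {l : Fin n} (hi : l ≠ i) (hj : l ≠ j) : setPair i j x s l = x l := by
  simp [setPair, hi, hj]

theorem eq_setPair_iff (hij : i ≠ j) {y : Config n q} :
    y = setPair i j x s ↔ (y i, y j) = s ∧ ∀ l, l ≠ i → l ≠ j → y l = x l := by
  constructor
  · rintro rfl
    exact ⟨by rw [setPair_fst x s hij, setPair_snd], fun l => setPair_of_ne x s⟩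
  · rintro ⟨rfl, h⟩
    ext1 l
    by_cases hj : l = j
    · subst hj; rw [setPair_snd]
    · by_cases hi : l = i
      · subst hi; rw [setPair_fst _ _ hij]
      · rw [setPair_of_ne _ _ hi hj, h l hi hj]

theorem setPair_setPair (hij : i ≠ j) : setPair i j (setPair i j x s) s' = setPair i j x s' := by
  rw [eq_setPair_iff _ _ hij]
  refine ⟨by rw [setPair_fst _ _ hij, setPair_snd], fun l hi hj => ?_⟩
  rw [setPair_of_ne _ _ hi hj, setPair_of_ne _ _ hi hj]

theorem setPair_self (hij : i ≠ j) : setPair i j x (x i, x j) = x :=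
  ((eq_setPair_iff x _ hij).mpr ⟨rfl, fun _ _ _ => rfl⟩).symm

/-- Exchanging the pair stored in `x` with `s` is an involution. This separates the sum over the
pair from the rest without splitting the configuration space, at the price of a factor `q²` per
copy. -/
theorem sum_sum_setPair (hij : i ≠ j) (f : Config n q → ℂ) :
    ∑ x, ∑ s, f (setPair i j x s) = (q : ℂ) ^ 2 * ∑ x, f x := by
  let φ : Config n q × (Fin q × Fin q) → Config n q × (Fin q × Fin q) := fun z =>
    (setPair i j z.1 z.2, (z.1 i, z.1 j))
  have hφ : Function.Involutive φ := by
    rintro ⟨x, s⟩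
    simp [φ, setPair_setPair _ _ _ hij, setPair_self _ hij, setPair_fst _ _ hij, setPair_snd]
  rw [← Fintype.sum_prod_type' fun x s => f (setPair i j x s),
    ← Equiv.sum_comp (hφ.toPerm φ) fun z : Config n q × (Fin q × Fin q) => f (setPair i j z.1 z.2)]
  have h : ∀ z, setPair i j (hφ.toPerm φ z).1 (hφ.toPerm φ z).2 = z.1 := fun z =>
    congrArg Prod.fst (hφ z)
  simp only [h, Fintype.sum_prod_type, Finset.sum_const, Finset.card_univ, Fintype.card_prod,
    Fintype.card_fin, nsmul_eq_mul, ← Finset.mul_sum]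
  push_cast
  ring

end setPair

/-- The pair that takes its components from `s'` where the decision is positive and from `s`
otherwise. -/
def mixPair (a b : Prop) [Decidable a] [Decidable b] (s s' : Fin q × Fin q) : Fin q × Fin q :=
  (if a then s'.1 else s.1, if b then s'.2 else s.2)

theorem piecewise_setPair {i j : Fin n} (hij : i ≠ j) {A B : Finset (Fin n)}
    (hAB : ∀ l, l ≠ i → l ≠ j → (l ∈ A ↔ l ∈ B)) (x x' : Config n q) (s s' : Fin q × Fin q) :
    B.piecewise (setPair i j x' s') (setPair i j x s) =
      setPair i j (A.piecewise x' x) (mixPair (i ∈ B) (j ∈ B) s s') := by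
  rw [eq_setPair_iff _ _ hij]
  refine ⟨?_, fun l hi hj => ?_⟩
  · simp only [Finset.piecewise, setPair_fst _ _ hij, setPair_snd, mixPair]
  · simp only [Finset.piecewise, setPair_of_ne _ _ hi hj, hAB l hi hj]

theorem Gate.toMatrix_mulVec (g : Gate n q) (α : Config n q → ℂ) (x : Config n q) :
    (g.toMatrix *ᵥ α) x =
      ∑ p, g.unitary.1 (x g.fst, x g.snd) p * α (setPair g.fst g.snd x p) := by
  simp only [Matrix.mulVec, dotProduct, Gate.toMatrix, ite_mul, zero_mul]
  rw [← Finset.sum_filter]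
  refine Finset.sum_nbij' (fun y => (y g.fst, y g.snd)) (fun p => setPair g.fst g.snd x p)
    (fun _ _ => Finset.mem_univ _) (fun p _ => ?_) (fun y hy => ?_) (fun p _ => ?_)
    (fun y hy => ?_)
  · rw [Finset.mem_filter]
    exact ⟨Finset.mem_univ _, fun l hi hj => (setPair_of_ne x p hi hj).symm⟩
  · rw [Finset.mem_filter] at hy
    exact ((eq_setPair_iff x _ g.fst_ne_snd).mpr ⟨rfl, fun l hi hj => (hy.2 l hi hj).symm⟩).symm
  · rw [setPair_fst _ _ g.fst_ne_snd, setPair_snd]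
  · rw [Finset.mem_filter] at hy
    rw [← (eq_setPair_iff x _ g.fst_ne_snd).mpr ⟨rfl, fun l hi hj => (hy.2 l hi hj).symm⟩]

theorem Gate.toMatrix_mulVec_setPair (g : Gate n q) (α : Config n q → ℂ) (x : Config n q)
    (s : Fin q × Fin q) :
    (g.toMatrix *ᵥ α) (setPair g.fst g.snd x s) =
      ∑ p, g.unitary.1 s p * α (setPair g.fst g.snd x p) := by
  simp only [g.toMatrix_mulVec, setPair_fst _ _ g.fst_ne_snd, setPair_snd,
    setPair_setPair _ _ _ g.fst_ne_snd]

/-- The overlap `⟨α ⊗ β| S_A |α ⊗ β⟩`, where `S_A` swaps the qudits in `A` of the two copies. -/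
noncomputable def swapOverlap (A : Finset (Fin n)) (α β : Config n q → ℂ) : ℂ :=
  ∑ x, ∑ x', star (α x) * star (β x') * (α (A.piecewise x' x) * β (A.piecewise x x'))

/-- The contribution of the values `p, p', r, r'` of the qudits `i, j` to a swap overlap, the other
qudits being fixed to their values in `x, x'`. -/
def overlapTerm (i j : Fin n) (A : Finset (Fin n)) (α β : Config n q → ℂ) (x x' : Config n q)
    (p p' r r' : Fin q × Fin q) : ℂ :=
  star (α (setPair i j x p)) * star (β (setPair i j x' p')) *
    (α (setPair i j (A.piecewise x' x) r) * β (setPair i j (A.piecewise x x') r'))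

theorem sum_sum_setPair₂ {i j : Fin n} (hij : i ≠ j) (f : Config n q → Config n q → ℂ) :
    ∑ x, ∑ x', ∑ s, ∑ s', f (setPair i j x s) (setPair i j x' s') =
      (q : ℂ) ^ 4 * ∑ x, ∑ x', f x x' := by
  have h : ∀ x : Config n q, ∑ x', ∑ s, ∑ s', f (setPair i j x s) (setPair i j x' s') =
      ∑ s, (q : ℂ) ^ 2 * ∑ x', f (setPair i j x s) x' := by
    intro x
    rw [Finset.sum_comm]
    simp only [sum_sum_setPair hij]
  simp only [h]
  rw [sum_sum_setPair hij fun x => (q : ℂ) ^ 2 * ∑ x', f x x', ← Finset.mul_sum]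
  ring

/-- The set `A` governs only the qudits outside the pair, so overlaps for sets differing at `i, j`
become sums of the same terms with different pair indices. -/
theorem swapOverlap_eq_sum_overlapTerm {i j : Fin n} (hij : i ≠ j) {A B : Finset (Fin n)}
    (hAB : ∀ l, l ≠ i → l ≠ j → (l ∈ A ↔ l ∈ B)) (α β : Config n q → ℂ) :
    (q : ℂ) ^ 4 * swapOverlap B α β = ∑ x, ∑ x', ∑ p, ∑ p', overlapTerm i j A α β x x' p p'
      (mixPair (i ∈ B) (j ∈ B) p p') (mixPair (i ∈ B) (j ∈ B) p' p) := by
  rw [swapOverlap, ← sum_sum_setPair₂ hij]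
  simp only [piecewise_setPair hij hAB]
  rfl

theorem swapOverlap_gate (g : Gate n q) (A : Finset (Fin n)) (α β : Config n q → ℂ) :
    (q : ℂ) ^ 4 * swapOverlap A (g.toMatrix *ᵥ α) (g.toMatrix *ᵥ β) =
      ∑ x, ∑ x', ∑ p, ∑ p', ∑ r, ∑ r',
        (∑ s, ∑ s', star (g.unitary.1 s p) * star (g.unitary.1 s' p') *
          (g.unitary.1 (mixPair (g.fst ∈ A) (g.snd ∈ A) s s') r *
            g.unitary.1 (mixPair (g.fst ∈ A) (g.snd ∈ A) s' s) r')) *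
          overlapTerm g.fst g.snd A α β x x' p p' r r' := by
  rw [swapOverlap_eq_sum_overlapTerm g.fst_ne_snd fun l _ _ => Iff.rfl]
  refine Finset.sum_congr rfl fun x _ => Finset.sum_congr rfl fun x' _ => ?_
  simp only [overlapTerm, g.toMatrix_mulVec_setPair]
  generalize mixPair (g.fst ∈ A) (g.snd ∈ A) = m
  simp only [Finset.sum_mul]
  have hR : ∀ F : (Fin q × Fin q) → (Fin q × Fin q) → (Fin q × Fin q) → (Fin q × Fin q) →
      (Fin q × Fin q) → (Fin q × Fin q) → ℂ,
      ∑ p, ∑ p', ∑ r, ∑ r', ∑ s, ∑ s', F p p' r r' s s' =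
        ∑ s, ∑ s', ∑ p, ∑ p', ∑ r, ∑ r', F p p' r r' s s' := by
    intro F
    simp_rw [sum_sum_comm_sum_sum (fun r r' s s' => F _ _ r r' s s')]
    rw [sum_sum_comm_sum_sum]
  rw [hR]
  refine Finset.sum_congr rfl fun s _ => Finset.sum_congr rfl fun s' _ => ?_
  simp only [star_sum, star_mul', Finset.sum_mul_sum]
  simp only [Finset.sum_mul, Finset.mul_sum]
  refine Finset.sum_congr rfl fun p _ =>
    ((Finset.sum_congr rfl fun r _ => Finset.sum_comm).trans Finset.sum_comm).trans <|
    Finset.sum_congr rfl fun p' _ => Finset.sum_congr rfl fun r _ => Finset.sum_congr rfl fun r' _ => ?_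
  ring

/-- A gate acting on two swapped qudits leaves a swap overlap unchanged. -/
theorem swapOverlap_gate_of_mem [NeZero q] (g : Gate n q) {A : Finset (Fin n)} (hi : g.fst ∈ A)
    (hj : g.snd ∈ A) (α β : Config n q → ℂ) :
    swapOverlap A (g.toMatrix *ᵥ α) (g.toMatrix *ᵥ β) = swapOverlap A α β := by
  have hK : ∀ p p' r r' : Fin q × Fin q,
      ∑ s, ∑ s', star (g.unitary.1 s p) * star (g.unitary.1 s' p') *
        (g.unitary.1 s' r * g.unitary.1 s r') =
      if p = r' then (if p' = r then 1 else 0) else 0 := by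
    intro p p' r r'
    rw [show (if p = r' then (if p' = r then (1 : ℂ) else 0) else 0) =
      (if p = r' then 1 else 0) * (if p' = r then 1 else 0) by split_ifs <;> simp,
      ← sum_star_mul_entry g.unitary, ← sum_star_mul_entry g.unitary, Finset.sum_mul_sum]
    refine Finset.sum_congr rfl fun s _ => Finset.sum_congr rfl fun s' _ => ?_
    ring
  have hq : (q : ℂ) ^ 4 ≠ 0 := pow_ne_zero 4 (NeZero.ne _)
  refine mul_left_cancel₀ hq ?_
  rw [swapOverlap_gate, swapOverlap_eq_sum_overlapTerm g.fst_ne_snd fun l _ _ => Iff.rfl]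
  refine Finset.sum_congr rfl fun x _ => Finset.sum_congr rfl fun x' _ =>
    Finset.sum_congr rfl fun p _ => Finset.sum_congr rfl fun p' _ => ?_
  simp only [mixPair, hi, hj, if_true, Prod.mk.eta, hK, ite_mul, one_mul, zero_mul,
    Finset.sum_ite_eq, Finset.mem_univ]

/-- The Haar average over a gate that acts on one swapped and one unswapped qudit. -/
theorem integral_swapOverlap_gate [NeZero q] {i j : Fin n} (hij : i ≠ j) {A : Finset (Fin n)}
    (hi : i ∈ A) (hj : j ∉ A) (α β : Config n q → ℂ) :
    ∫ V, swapOverlap A ((Gate.mk i j hij V).toMatrix *ᵥ α) ((Gate.mk i j hij V).toMatrix *ᵥ β)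
        ∂(haarUnitary q) =
      (q : ℂ) / ((q : ℂ) ^ 2 + 1) *
        (swapOverlap (A.erase i) α β + swapOverlap (insert j A) α β) := by
  have hq : (q : ℂ) ^ 4 ≠ 0 := pow_ne_zero 4 (NeZero.ne _)
  have h : ∀ V : TwoQuditUnitary q, (q : ℂ) ^ 4 * swapOverlap A ((Gate.mk i j hij V).toMatrix *ᵥ α)
      ((Gate.mk i j hij V).toMatrix *ᵥ β) = ∑ x, ∑ x', ∑ p, ∑ p', ∑ r, ∑ r',
        swapKernel V p p' r r' * overlapTerm i j A α β x x' p p' r r' := by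
    intro V
    rw [swapOverlap_gate]
    simp only [mixPair, hi, hj, if_true, if_false, swapKernel]
  have hint : ∀ (z : ℂ) (p p' r r' : Fin q × Fin q),
      Integrable (fun V => swapKernel V p p' r r' * z) (haarUnitary q) := fun z p p' r r' =>
    (integrable_haarUnitary (continuous_swapKernel p p' r r')).mul_const z
  refine mul_left_cancel₀ hq ?_
  rw [← integral_const_mul]
  simp only [h]
  have hmean : ∀ x x', ∫ V, (∑ p, ∑ p', ∑ r, ∑ r',
      swapKernel V p p' r r' * overlapTerm i j A α β x x' p p' r r') ∂(haarUnitary q) =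
      (q : ℂ) / ((q : ℂ) ^ 2 + 1) * ∑ p, ∑ p', (overlapTerm i j A α β x x' p p' p p' +
        overlapTerm i j A α β x x' p p' p' p) := by
    intro x x'
    rw [integral_finsetSum _ fun p _ => integrable_finsetSum _ fun p' _ =>
      integrable_finsetSum _ fun r _ => integrable_finsetSum _ fun r' _ => hint _ p p' r r',
      Finset.mul_sum]
    refine Finset.sum_congr rfl fun p _ => ?_
    rw [integral_finsetSum _ fun p' _ =>
      integrable_finsetSum _ fun r _ => integrable_finsetSum _ fun r' _ => hint _ p p' r r',
      Finset.mul_sum]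
    refine Finset.sum_congr rfl fun p' _ => ?_
    rw [integral_finsetSum _ fun r _ => integrable_finsetSum _ fun r' _ => hint _ p p' r r']
    simp_rw [integral_finsetSum _ fun r' _ => hint _ p p' _ r', integral_mul_const]
    have := fun r r' => meanSwapKernel_eq p p' r r'
    simp only [meanSwapKernel] at this
    simp only [this, mul_assoc, ← Finset.mul_sum, add_mul, Finset.sum_add_distrib, ite_and, ite_mul,
      one_mul, zero_mul]
    simp
  have hint' : ∀ x x', Integrable (fun V => ∑ p, ∑ p', ∑ r, ∑ r',
      swapKernel V p p' r r' * overlapTerm i j A α β x x' p p' r r') (haarUnitary q) := fun x x' =>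
    integrable_finsetSum _ fun p _ => integrable_finsetSum _ fun p' _ =>
      integrable_finsetSum _ fun r _ => integrable_finsetSum _ fun r' _ => hint _ p p' r r'
  rw [integral_finsetSum _ fun x _ => integrable_finsetSum _ fun x' _ => hint' x x']
  simp_rw [integral_finsetSum _ fun x' _ => hint' _ x', hmean]
  -- The identity in the twirl leaves neither qudit of the pair swapped, the full swap leaves both
  -- swapped.
  rw [show ∀ a b c d : ℂ, a * (b * (c + d)) = b * (a * c + a * d) by intros; ring,
    swapOverlap_eq_sum_overlapTerm hij (A := A) (B := A.erase i)
      (fun l hi _ => by simp [hi]),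
    swapOverlap_eq_sum_overlapTerm hij (A := A) (B := insert j A)
      (fun l _ hj => by simp [hj])]
  simp only [mixPair, hi, hj, hij, Finset.mem_erase, Finset.mem_insert, ne_eq, not_true, false_and,
    and_false, or_true, true_or, if_true, if_false, Finset.sum_add_distrib, ← Finset.mul_sum]

/-- The Haar average of the squared modulus of a matrix element of a gate. -/
theorem integral_normSq_gate [NeZero q] {i j : Fin n} (hij : i ≠ j) (α β : Config n q → ℂ) :
    ∫ V, star (star α ⬝ᵥ ((Gate.mk i j hij V).toMatrix *ᵥ β)) *
        (star α ⬝ᵥ ((Gate.mk i j hij V).toMatrix *ᵥ β)) ∂(haarUnitary q) =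
      ((q : ℂ) ^ 2)⁻¹ * swapOverlap (Finset.univ.filter fun l => l ≠ i ∧ l ≠ j) α β := by
  have hq : (q : ℂ) ^ 4 ≠ 0 := pow_ne_zero 4 (NeZero.ne _)
  have hov : ∀ V : TwoQuditUnitary q, (q : ℂ) ^ 2 *
      (star α ⬝ᵥ ((Gate.mk i j hij V).toMatrix *ᵥ β)) =
      ∑ x, ∑ s, ∑ p, star (α (setPair i j x s)) * (V.1 s p * β (setPair i j x p)) := by
    intro V
    rw [dotProduct, ← sum_sum_setPair hij]
    refine Finset.sum_congr rfl fun x _ => Finset.sum_congr rfl fun s _ => ?_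
    rw [Pi.star_apply, (Gate.mk i j hij V).toMatrix_mulVec_setPair β x s, Finset.mul_sum]
  have hexp : ∀ V : TwoQuditUnitary q, (q : ℂ) ^ 4 *
      (star (star α ⬝ᵥ ((Gate.mk i j hij V).toMatrix *ᵥ β)) *
        (star α ⬝ᵥ ((Gate.mk i j hij V).toMatrix *ᵥ β))) =
      ∑ x, ∑ x', ∑ s, ∑ p, ∑ s', ∑ p', V.1 s p * star (V.1 s' p') *
        (star (α (setPair i j x s)) * β (setPair i j x p) *
          (α (setPair i j x' s') * star (β (setPair i j x' p')))) := by
    intro V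
    rw [show ∀ z : ℂ, (q : ℂ) ^ 4 * (star z * z) = ((q : ℂ) ^ 2 * z) * star ((q : ℂ) ^ 2 * z) by
      intro z
      rw [star_mul', star_pow, star_natCast]
      ring, hov]
    simp only [star_sum]
    rw [Finset.sum_mul_sum]
    refine Finset.sum_congr rfl fun x _ => Finset.sum_congr rfl fun x' _ => ?_
    simp only [Finset.sum_mul]
    simp only [Finset.mul_sum, star_mul', star_star]
    refine Finset.sum_congr rfl fun s _ => Finset.sum_congr rfl fun p _ =>
      Finset.sum_congr rfl fun s' _ => Finset.sum_congr rfl fun p' _ => ?_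
    ring
  have hint : ∀ (z : ℂ) (s p s' p' : Fin q × Fin q),
      Integrable (fun V : TwoQuditUnitary q => V.1 s p * star (V.1 s' p') * z) (haarUnitary q) :=
    fun z s p s' p' => (integrable_haarUnitary
      ((continuous_entry s p).mul (continuous_entry s' p').star)).mul_const z
  refine mul_left_cancel₀ hq ?_
  rw [← integral_const_mul]
  simp only [hexp]
  -- The moments force `s' = s` and `p' = p`. Then `α` occurs at `x` and `x'` with the same pair,
  -- and so does `β`: everything outside the pair is swapped, hence `Finset.univ`.
  have hmean : ∀ x x' : Config n q, ∫ V : TwoQuditUnitary q, (∑ s, ∑ p, ∑ s', ∑ p',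
      V.1 s p * star (V.1 s' p') * (star (α (setPair i j x s)) * β (setPair i j x p) *
          (α (setPair i j x' s') * star (β (setPair i j x' p'))))) ∂(haarUnitary q) =
      ((q : ℂ) ^ 2)⁻¹ * ∑ s, ∑ p, overlapTerm i j Finset.univ α β x x' s p s p := by
    intro x x'
    rw [integral_finsetSum _ fun s _ => integrable_finsetSum _ fun p _ =>
      integrable_finsetSum _ fun s' _ => integrable_finsetSum _ fun p' _ => hint _ s p s' p',
      Finset.mul_sum]
    refine Finset.sum_congr rfl fun s _ => ?_
    rw [integral_finsetSum _ fun p _ =>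
      integrable_finsetSum _ fun s' _ => integrable_finsetSum _ fun p' _ => hint _ s p s' p',
      Finset.mul_sum]
    refine Finset.sum_congr rfl fun p _ => ?_
    rw [integral_finsetSum _ fun s' _ => integrable_finsetSum _ fun p' _ => hint _ s p s' p']
    simp_rw [integral_finsetSum _ fun p' _ => hint _ s p _ p', integral_mul_const,
      integral_entry_mul_star_entry, ite_and, ite_mul, zero_mul]
    simp only [Finset.sum_ite_irrel, Finset.sum_ite_eq, Finset.mem_univ, if_true,
      Finset.sum_const_zero, overlapTerm, Finset.piecewise_univ]
    ring
  have hint' : ∀ x x' : Config n q, Integrable (fun V : TwoQuditUnitary q => ∑ s, ∑ p, ∑ s', ∑ p',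
      V.1 s p * star (V.1 s' p') * (star (α (setPair i j x s)) * β (setPair i j x p) *
          (α (setPair i j x' s') * star (β (setPair i j x' p'))))) (haarUnitary q) := fun x x' =>
    integrable_finsetSum _ fun s _ => integrable_finsetSum _ fun p _ =>
      integrable_finsetSum _ fun s' _ => integrable_finsetSum _ fun p' _ => hint _ s p s' p'
  rw [integral_finsetSum _ fun x _ => integrable_finsetSum _ fun x' _ => hint' x x']
  simp_rw [integral_finsetSum _ fun x' _ => hint' _ x', hmean]
  rw [mul_left_comm, swapOverlap_eq_sum_overlapTerm hij (A := Finset.univ)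
    (B := Finset.univ.filter fun l => l ≠ i ∧ l ≠ j) (fun l hi hj => by simp [hi, hj])]
  simp only [mixPair, Finset.mem_filter, ne_eq, not_true, false_and, and_false, if_false,
    ← Finset.mul_sum]

end Overlap
end RewindingProtocol

namespace RewindingProtocol

/-! ### Resampling one gate of a family of independent gates -/

section Resampling

instance instIsProbabilityMeasureGateMeasure (n q : ℕ) : IsProbabilityMeasure (gateMeasure n q) := by
  unfold gateMeasure; infer_instance

/-- On boxes: the side at `j` is tested on the new sample, and the discarded coordinate ranges over
a space of mass one. Fubini for one gate follows without splitting the index type. -/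
theorem measurePreserving_update {ι G : Type*} [Fintype ι] [DecidableEq ι] [MeasurableSpace G]
    (μ : Measure G) [IsProbabilityMeasure μ] (j : ι) :
    MeasurePreserving (fun z : (ι → G) × G => Function.update z.1 j z.2)
      ((Measure.pi fun _ => μ).prod μ) (Measure.pi fun _ => μ) := by
  have hm : Measurable fun z : (ι → G) × G => Function.update z.1 j z.2 := by
    rw [measurable_pi_iff]
    intro i
    by_cases h : i = j
    · subst h; simpa using measurable_snd
    · simpa [h, Function.comp_def] using (measurable_pi_apply i).comp measurable_fst
  refine ⟨hm, (Measure.pi_eq fun s hs => ?_).symm⟩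
  rw [Measure.map_apply hm (MeasurableSet.univ_pi hs)]
  have hpre : (fun z : (ι → G) × G => Function.update z.1 j z.2) ⁻¹' Set.univ.pi s =
      (Set.univ.pi (Function.update s j Set.univ)) ×ˢ s j := by
    ext ⟨U, V⟩
    simp only [Set.mem_preimage, Set.mem_univ_pi, Set.mem_prod]
    constructor
    · intro h
      refine ⟨fun i => ?_, by simpa using h j⟩
      by_cases hi : i = j
      · subst hi; simp
      · simpa [hi] using h i
    · rintro ⟨h1, h2⟩ i
      by_cases hi : i = j
      · subst hi; simpa using h2
      · simpa [hi] using h1 i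
  rw [hpre, Measure.prod_prod, Measure.pi_pi]
  have h : ∀ i, μ (Function.update s j Set.univ i) =
      Function.update (fun i => μ (s i)) j 1 i := by
    intro i
    by_cases hi : i = j
    · subst hi; simp
    · simp [hi]
  simp only [h]
  rw [Finset.prod_update_of_mem (Finset.mem_univ j), one_mul,
    Finset.prod_eq_prod_sdiff_singleton_mul (Finset.mem_univ j)]

variable {n q : ℕ}

theorem integrable_gateMeasure {f : (Fin (n - 1) → TwoQuditUnitary q) → ℂ} (hf : Continuous f) :
    Integrable f (gateMeasure n q) :=
  hf.integrable_of_hasCompactSupport (HasCompactSupport.of_compactSpace f)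

theorem integral_gateMeasure_update {f : (Fin (n - 1) → TwoQuditUnitary q) → ℂ} (hf : Continuous f)
    (j : Fin (n - 1)) :
    ∫ U, f U ∂(gateMeasure n q) =
      ∫ U, ∫ V, f (Function.update U j V) ∂(haarUnitary q) ∂(gateMeasure n q) := by
  have hmp := measurePreserving_update (haarUnitary q) j
  have hint : Integrable f (Measure.pi fun _ : Fin (n - 1) => haarUnitary q) :=
    integrable_gateMeasure hf
  unfold gateMeasure
  rw [← hmp.map_eq, integral_map hmp.measurable.aemeasurable
    (hmp.map_eq.symm ▸ hint.aestronglyMeasurable), hmp.map_eq]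
  exact integral_prod _ (hmp.integrable_comp_of_integrable hint)

end Resampling

/-! ### The convolutional circuit and its rewinding circuit -/

section Circuit

variable {n q : ℕ}

theorem Circuit.toMatrix_append (C D : Circuit n q) :
    Circuit.toMatrix (C ++ D) = Circuit.toMatrix D * Circuit.toMatrix C := by
  induction C with
  | nil => simp [Circuit.toMatrix]
  | cons g C ih => simp [Circuit.toMatrix, ih, Matrix.mul_assoc]

theorem Gate.toMatrix_adjoint (g : Gate n q) : g.adjoint.toMatrix = g.toMatrixᴴ := by
  ext x y
  simp only [Gate.toMatrix, Gate.adjoint, Matrix.conjTranspose_apply, eq_comm (a := x _)]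
  split_ifs
  · rfl
  · simp

theorem Circuit.toMatrix_reverse_map_adjoint (C : Circuit n q) :
    Circuit.toMatrix (C.reverse.map Gate.adjoint) = (Circuit.toMatrix C)ᴴ := by
  induction C with
  | nil => simp [Circuit.toMatrix]
  | cons g C ih =>
    rw [List.reverse_cons, List.map_append, Circuit.toMatrix_append, ih]
    simp [Circuit.toMatrix, Gate.toMatrix_adjoint]

/-- The gate `V` acting on the qudits `j` and `j + 1`. -/
def neighbourGate (j : Fin (n - 1)) (V : TwoQuditUnitary q) : Gate n q where
  fst := ⟨j.val, by omega⟩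
  snd := ⟨j.val + 1, by omega⟩
  fst_ne_snd := by simp
  unitary := V

/-- The operator implemented by the first `m` gates of the convolutional circuit. -/
noncomputable def prefixMatrix (U : Fin (n - 1) → TwoQuditUnitary q) (m : ℕ) :
    Matrix (Config n q) (Config n q) ℂ :=
  Circuit.toMatrix ((convolutionalCircuit U).take m)

variable (U : Fin (n - 1) → TwoQuditUnitary q)

theorem convolutionalCircuit_take_succ {m : ℕ} (hm : m < n - 1) :
    (convolutionalCircuit U).take (m + 1) =
      (convolutionalCircuit U).take m ++ [neighbourGate ⟨m, hm⟩ (U ⟨m, hm⟩)] := by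
  rw [List.take_add_one]
  congr 1
  simp [convolutionalCircuit, neighbourGate, hm]

theorem prefixMatrix_zero : prefixMatrix U 0 = 1 := by
  simp [prefixMatrix, Circuit.toMatrix]

theorem prefixMatrix_succ {m : ℕ} (hm : m < n - 1) :
    prefixMatrix U (m + 1) =
      (neighbourGate ⟨m, hm⟩ (U ⟨m, hm⟩)).toMatrix * prefixMatrix U m := by
  rw [prefixMatrix, convolutionalCircuit_take_succ U hm, Circuit.toMatrix_append]
  simp [Circuit.toMatrix, prefixMatrix]

theorem toMatrix_convolutionalCircuit :
    Circuit.toMatrix (convolutionalCircuit U) = prefixMatrix U (n - 1) := by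
  rw [prefixMatrix, List.take_of_length_le]
  simp [convolutionalCircuit]

/-- The gate with index `m` is the first one outside the prefix, so it can be averaged with the
prefix fixed. -/
theorem prefixMatrix_update {m : ℕ} (hm : m < n - 1) (V : TwoQuditUnitary q) :
    prefixMatrix (Function.update U ⟨m, hm⟩ V) m = prefixMatrix U m := by
  unfold prefixMatrix
  congr 1
  refine List.ext_getElem (by simp [convolutionalCircuit]) fun l h₁ h₂ => ?_
  have hl : l < m := by
    rw [List.length_take] at h₁
    omega
  simp [convolutionalCircuit, Function.update_of_ne, Fin.ext_iff, hl.ne]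

theorem idlePart_convolutionalCircuit (hn : 2 ≤ n) :
    idlePart (convolutionalIdle n) (convolutionalCircuit U) =
      (convolutionalCircuit U).take (n - 2) := by
  have hlen : (convolutionalCircuit U).take (n - 2 + 1) = convolutionalCircuit U :=
    List.take_of_length_le (by simp [convolutionalCircuit]; omega)
  rw [idlePart]
  -- Only the last gate touches the non-idle qudit.
  conv_lhs => rw [← hlen, convolutionalCircuit_take_succ U (by omega), List.filter_append]
  rw [List.filter_eq_self.mpr, List.filter_eq_nil_iff.mpr, List.append_nil]
  · intro g hg
    rw [List.mem_singleton] at hg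
    subst hg
    simp [neighbourGate, convolutionalIdle]
    omega
  · intro g hg
    obtain ⟨l, hl, rfl⟩ := List.getElem_of_mem hg
    rw [List.length_take] at hl
    simp [convolutionalCircuit, convolutionalIdle]
    omega

theorem toMatrix_rewindingCircuit (hn : 2 ≤ n) :
    Circuit.toMatrix (rewindingCircuit (convolutionalIdle n) (convolutionalCircuit U)) =
      (prefixMatrix U (n - 2))ᴴ := by
  rw [rewindingCircuit, idlePart_convolutionalCircuit U hn, Circuit.toMatrix_reverse_map_adjoint,
    prefixMatrix]

/-- The image of the basis state `|y⟩` under the first `m` gates of the convolutional circuit. -/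
noncomputable def prefixState (m : ℕ) (y : Config n q) : Config n q → ℂ :=
  prefixMatrix U m *ᵥ Pi.single y 1

theorem rewoundState_convolutionalCircuit [NeZero q] (hn : 2 ≤ n) (hm : n - 2 < n - 1)
    (y : Config n q) :
    rewoundState (convolutionalIdle n) (convolutionalCircuit U) y =
      star (prefixState U (n - 2) y) ⬝ᵥ
        ((neighbourGate ⟨n - 2, hm⟩ (U ⟨n - 2, hm⟩)).toMatrix *ᵥ prefixState U (n - 2) 0) := by
  have h : n - 1 = n - 2 + 1 := by omega
  rw [rewoundState, toMatrix_rewindingCircuit U hn, toMatrix_convolutionalCircuit]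
  have h' : prefixMatrix U (n - 1) = prefixMatrix U (n - 2 + 1) := congrArg _ h
  rw [h', prefixMatrix_succ U hm, ← Matrix.mulVec_mulVec, ← Matrix.mulVec_mulVec]
  change (prefixMatrix U (n - 2))ᴴ y ⬝ᵥ _ = _
  congr 1
  ext x
  simp [prefixState]

theorem convolutionalFidelity_eq [NeZero q] (k : ℕ) :
    convolutionalFidelity k U = ∑ y : Config n q, if ∀ i : Fin n, i.val < k → y i = 0 then
      star (rewoundState (convolutionalIdle n) (convolutionalCircuit U) y) *
        rewoundState (convolutionalIdle n) (convolutionalCircuit U) y else 0 := by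
  rw [convolutionalFidelity, resetFidelity, firstQuditsProjector, dotProduct]
  refine Finset.sum_congr rfl fun y _ => ?_
  rw [Matrix.mulVec_diagonal, Pi.star_apply]
  split_ifs <;> simp

theorem continuous_toMatrix_neighbourGate (j : Fin (n - 1)) :
    Continuous fun U : Fin (n - 1) → TwoQuditUnitary q => (neighbourGate j (U j)).toMatrix := by
  refine continuous_matrix fun x y => ?_
  by_cases h : ∀ l : Fin n, l ≠ ⟨j.val, by omega⟩ → l ≠ ⟨j.val + 1, by omega⟩ → x l = y l
  · exact ((continuous_entry (x ⟨j.val, by omega⟩, x ⟨j.val + 1, by omega⟩)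
      (y ⟨j.val, by omega⟩, y ⟨j.val + 1, by omega⟩)).comp (continuous_apply j)).congr
        fun U => (if_pos h).symm
  · exact continuous_const.congr fun U => (if_neg h).symm

theorem continuous_prefixMatrix {m : ℕ} (hm : m ≤ n - 1) :
    Continuous fun U : Fin (n - 1) → TwoQuditUnitary q => prefixMatrix U m := by
  induction m with
  | zero => simpa only [prefixMatrix_zero] using continuous_const
  | succ m ih =>
    simp only [prefixMatrix_succ _ (Nat.lt_of_succ_le hm)]
    exact (continuous_toMatrix_neighbourGate _).matrix_mul
      (ih (Nat.le_of_succ_le hm))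

theorem continuous_prefixState {m : ℕ} (hm : m ≤ n - 1) (y : Config n q) :
    Continuous fun U : Fin (n - 1) → TwoQuditUnitary q => prefixState U m y :=
  (continuous_prefixMatrix hm).matrix_mulVec continuous_const

theorem continuous_rewoundState_convolutionalCircuit [NeZero q] (hn : 2 ≤ n) (y : Config n q) :
    Continuous fun U : Fin (n - 1) → TwoQuditUnitary q =>
      rewoundState (convolutionalIdle n) (convolutionalCircuit U) y := by
  have hm : n - 2 < n - 1 := by omega
  simp only [rewoundState_convolutionalCircuit _ hn hm]
  exact (continuous_prefixState hm.le y).star.dotProduct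
    ((continuous_toMatrix_neighbourGate _).matrix_mulVec
      (continuous_prefixState hm.le 0))

theorem continuous_convolutionalFidelity [NeZero q] (hn : 2 ≤ n) (k : ℕ) :
    Continuous fun U : Fin (n - 1) → TwoQuditUnitary q => convolutionalFidelity k U := by
  simp only [convolutionalFidelity_eq]
  refine continuous_finsetSum _ fun y _ => ?_
  split_ifs
  · exact (continuous_rewoundState_convolutionalCircuit hn y).star.mul
      (continuous_rewoundState_convolutionalCircuit hn y)
  · exact continuous_const

theorem continuous_swapOverlap {X : Type*} [TopologicalSpace X] (A : Finset (Fin n))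
    {α β : X → Config n q → ℂ} (hα : Continuous α) (hβ : Continuous β) :
    Continuous fun x => swapOverlap A (α x) (β x) := by
  unfold swapOverlap
  fun_prop

end Circuit
end RewindingProtocol

namespace RewindingProtocol

/-! ### The averaged fidelity -/

section Average

variable {n q : ℕ}

/-- The first `m` of `n` qudits. -/
def initialQudits (n m : ℕ) : Finset (Fin n) :=
  Finset.univ.filter fun i => i.val < m

theorem mem_initialQudits {m : ℕ} {i : Fin n} : i ∈ initialQudits n m ↔ i.val < m := by
  simp [initialQudits]

theorem prefixState_succ (U : Fin (n - 1) → TwoQuditUnitary q) {m : ℕ} (hm : m < n - 1)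
    (y : Config n q) :
    prefixState U (m + 1) y =
      (neighbourGate ⟨m, hm⟩ (U ⟨m, hm⟩)).toMatrix *ᵥ prefixState U m y := by
  rw [prefixState, prefixMatrix_succ U hm, ← Matrix.mulVec_mulVec, prefixState]

theorem prefixState_update (U : Fin (n - 1) → TwoQuditUnitary q) {m : ℕ} (hm : m < n - 1)
    (V : TwoQuditUnitary q) (y : Config n q) :
    prefixState (Function.update U ⟨m, hm⟩ V) m y = prefixState U m y := by
  rw [prefixState, prefixMatrix_update, prefixState]

/-- The first `m` gates touch `m + 1` qudits, all swapped when `m + 1 ≤ t`, so each gate cancels. -/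
theorem swapOverlap_prefixState [NeZero q] (U : Fin (n - 1) → TwoQuditUnitary q) {m t : ℕ}
    (hm : m ≤ n - 1) (hmt : m + 1 ≤ t) (y y' : Config n q) :
    swapOverlap (initialQudits n t) (prefixState U m y) (prefixState U m y') =
      swapOverlap (initialQudits n t) (Pi.single y 1) (Pi.single y' 1) := by
  induction m with
  | zero => simp only [prefixState, prefixMatrix_zero, Matrix.one_mulVec]
  | succ m ih =>
    rw [prefixState_succ U (Nat.lt_of_succ_le hm), prefixState_succ U (Nat.lt_of_succ_le hm),
      swapOverlap_gate_of_mem, ih (by omega) (by omega)]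
    · rw [mem_initialQudits]; simp only [neighbourGate]; omega
    · rw [mem_initialQudits]; simp only [neighbourGate]; omega

theorem swapOverlap_single [NeZero q] (A : Finset (Fin n)) (y : Config n q) :
    swapOverlap A (Pi.single y 1) (Pi.single 0 1) = if ∀ i ∈ A, y i = 0 then 1 else 0 := by
  rw [swapOverlap, Finset.sum_eq_single y, Finset.sum_eq_single 0]
  · have h1 : A.piecewise 0 y = y ↔ ∀ i ∈ A, y i = 0 := by
      simp only [funext_iff, Finset.piecewise]
      refine forall_congr' fun i => ?_
      by_cases hi : i ∈ A <;> simp [hi, eq_comm]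
    have h2 : A.piecewise y 0 = (0 : Config n q) ↔ ∀ i ∈ A, y i = 0 := by
      simp only [funext_iff, Finset.piecewise]
      refine forall_congr' fun i => ?_
      by_cases hi : i ∈ A <;> simp [hi]
    simp only [Pi.single_apply, h1, h2]
    split_ifs <;> simp
  · intro x _ hx; simp [Pi.single_eq_of_ne hx]
  · simp
  · intro x _ hx; simp [Pi.single_eq_of_ne hx]
  · simp

/-- The mean swap overlap, on the first `m` qudits, of the images of `|y⟩` and `|0 ⋯ 0⟩` under the
first `m` gates. -/
noncomputable def meanOverlap [NeZero q] (m : ℕ) (y : Config n q) : ℂ :=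
  ∫ U, swapOverlap (initialQudits n m) (prefixState U m y) (prefixState U m 0) ∂(gateMeasure n q)

theorem continuous_swapOverlap_prefixState [NeZero q] (A : Finset (Fin n)) {m : ℕ} (hm : m ≤ n - 1)
    (y : Config n q) :
    Continuous fun U : Fin (n - 1) → TwoQuditUnitary q =>
      swapOverlap A (prefixState U m y) (prefixState U m 0) :=
  continuous_swapOverlap A (continuous_prefixState hm y) (continuous_prefixState hm 0)

theorem meanOverlap_zero [NeZero q] (y : Config n q) : meanOverlap 0 y = 1 := by
  have h : initialQudits n 0 = ∅ := by simp [initialQudits]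
  simp only [meanOverlap, prefixState, prefixMatrix_zero, Matrix.one_mulVec, h, swapOverlap_single]
  simp

/-- The new gate straddles the edge of the block of `m + 1` swapped qudits. The twirl gives a block
of `m`, which is the previous overlap, and a block of `m + 2`, where the earlier gates drop out. -/
theorem meanOverlap_succ [NeZero q] {m : ℕ} (hm : m < n - 1) (y : Config n q) :
    meanOverlap (m + 1) y = (q : ℂ) / ((q : ℂ) ^ 2 + 1) *
      (meanOverlap m y + if ∀ i : Fin n, i.val < m + 2 → y i = 0 then 1 else 0) := by
  have h1 : (initialQudits n (m + 1)).erase ⟨m, by omega⟩ = initialQudits n m := by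
    ext i
    simp only [Finset.mem_erase, mem_initialQudits, ne_eq, Fin.ext_iff]
    omega
  have h2 : insert ⟨m + 1, by omega⟩ (initialQudits n (m + 1)) = initialQudits n (m + 2) := by
    ext i
    simp only [Finset.mem_insert, mem_initialQudits, Fin.ext_iff]
    omega
  have h3 : ∀ U : Fin (n - 1) → TwoQuditUnitary q, ∫ V, swapOverlap (initialQudits n (m + 1))
      (prefixState (Function.update U ⟨m, hm⟩ V) (m + 1) y)
      (prefixState (Function.update U ⟨m, hm⟩ V) (m + 1) 0) ∂(haarUnitary q) =
      (q : ℂ) / ((q : ℂ) ^ 2 + 1) *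
        (swapOverlap (initialQudits n m) (prefixState U m y) (prefixState U m 0) +
          if ∀ i : Fin n, i.val < m + 2 → y i = 0 then 1 else 0) := by
    intro U
    simp only [prefixState_succ _ hm, prefixState_update, Function.update_self]
    have := integral_swapOverlap_gate (q := q) (i := ⟨m, by omega⟩) (j := ⟨m + 1, by omega⟩)
      (by simp) (A := initialQudits n (m + 1)) (mem_initialQudits.mpr (by simp))
      (mem_initialQudits.not.mpr (by simp)) (prefixState U m y) (prefixState U m 0)
    rw [h1, h2, swapOverlap_prefixState U (t := m + 2) hm.le (by omega), swapOverlap_single] at this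
    simp only [mem_initialQudits] at this
    exact this
  rw [meanOverlap, integral_gateMeasure_update (continuous_swapOverlap_prefixState _ hm y) ⟨m, hm⟩]
  simp only [h3]
  rw [integral_const_mul, integral_add
    (integrable_gateMeasure (continuous_swapOverlap_prefixState _ hm.le y)) (integrable_const _)]
  simp [meanOverlap]

theorem averagedFidelity_eq_sum [NeZero q] (hn : 2 ≤ n) (k : ℕ) :
    averagedFidelity n q k = ((q : ℂ) ^ 2)⁻¹ *
      ∑ y : Config n q, if ∀ i : Fin n, i.val < k → y i = 0 then meanOverlap (n - 2) y else 0 := by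
  have hm : n - 2 < n - 1 := by omega
  have hA : (Finset.univ.filter fun l : Fin n => l ≠ ⟨n - 2, by omega⟩ ∧ l ≠ ⟨n - 2 + 1, by omega⟩) =
      initialQudits n (n - 2) := by
    ext i
    simp only [Finset.mem_filter, Finset.mem_univ, true_and, mem_initialQudits, ne_eq, Fin.ext_iff]
    omega
  have hcont : ∀ y : Config n q, Continuous fun U : Fin (n - 1) → TwoQuditUnitary q =>
      star (rewoundState (convolutionalIdle n) (convolutionalCircuit U) y) *
        rewoundState (convolutionalIdle n) (convolutionalCircuit U) y := fun y =>
    (continuous_rewoundState_convolutionalCircuit hn y).star.mul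
      (continuous_rewoundState_convolutionalCircuit hn y)
  have hy : ∀ y : Config n q,
      ∫ U, star (rewoundState (convolutionalIdle n) (convolutionalCircuit U) y) *
        rewoundState (convolutionalIdle n) (convolutionalCircuit U) y ∂(gateMeasure n q) =
      ((q : ℂ) ^ 2)⁻¹ * meanOverlap (n - 2) y := by
    intro y
    rw [integral_gateMeasure_update (hcont y) ⟨n - 2, hm⟩, meanOverlap, ← integral_const_mul]
    congr 1
    ext U
    simp only [rewoundState_convolutionalCircuit _ hn hm, prefixState_update, Function.update_self]
    have := integral_normSq_gate (q := q) (i := (⟨n - 2, by omega⟩ : Fin n))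
      (j := ⟨n - 2 + 1, by omega⟩) (by simp) (prefixState U (n - 2) y) (prefixState U (n - 2) 0)
    rw [hA] at this
    exact this
  rw [averagedFidelity]
  simp only [convolutionalFidelity_eq]
  rw [integral_finsetSum, Finset.mul_sum]
  · refine Finset.sum_congr rfl fun y _ => ?_
    split_ifs
    · exact hy y
    · simp
  · intro y _
    split_ifs
    · exact integrable_gateMeasure (hcont y)
    · exact integrable_zero _ _ _

/-! ### Summation over basis states and solution of the recurrence -/

theorem sum_ite_forall_lt_eq_zero [NeZero q] {t : ℕ} (ht : t ≤ n) :
    (∑ y : Config n q, if ∀ i : Fin n, i.val < t → y i = 0 then (1 : ℂ) else 0) =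
      (q : ℂ) ^ (n - t) := by
  have h : (Finset.univ.filter fun y : Config n q => ∀ i : Fin n, i.val < t → y i = 0) =
      Fintype.piFinset fun i : Fin n => if i.val < t then {0} else Finset.univ := by
    ext y
    simp only [Finset.mem_filter, Finset.mem_univ, true_and, Fintype.mem_piFinset]
    refine forall_congr' fun i => ?_
    by_cases hi : i.val < t <;> simp [hi]
  have hc : (Finset.univ.filter fun i : Fin n => ¬ i.val < t).card = n - t := by
    have h1 := Finset.card_filter_add_card_filter_not (s := (Finset.univ : Finset (Fin n)))
      (fun i => i.val < t)
    rw [Fin.card_filter_val_lt, Finset.card_univ, Fintype.card_fin, min_eq_right ht] at h1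
    omega
  rw [Finset.sum_boole, h, Fintype.card_piFinset]
  simp only [apply_ite Finset.card, Finset.card_singleton, Finset.card_univ, Fintype.card_fin,
    Finset.prod_ite, Finset.prod_const, hc, one_pow, one_mul, Nat.cast_pow]

/-- The sum of the mean overlaps over all `y` that vanish on the first `k` qudits. -/
noncomputable def sumMeanOverlap (n q k : ℕ) [NeZero q] (m : ℕ) : ℂ :=
  ∑ y : Config n q, if ∀ i : Fin n, i.val < k → y i = 0 then meanOverlap m y else 0

theorem sumMeanOverlap_zero [NeZero q] {k : ℕ} (hk : k ≤ n) :
    sumMeanOverlap n q k 0 = (q : ℂ) ^ (n - k) := by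
  simp only [sumMeanOverlap, meanOverlap_zero, sum_ite_forall_lt_eq_zero hk]

theorem sumMeanOverlap_succ [NeZero q] {k m : ℕ} (hk : k ≤ n) (hm : m < n - 1) :
    sumMeanOverlap n q k (m + 1) = (q : ℂ) / ((q : ℂ) ^ 2 + 1) *
      (sumMeanOverlap n q k m + (q : ℂ) ^ (n - max k (m + 2))) := by
  rw [← sum_ite_forall_lt_eq_zero (q := q) (n := n) (t := max k (m + 2)) (by omega),
    sumMeanOverlap, sumMeanOverlap, ← Finset.sum_add_distrib, Finset.mul_sum]
  refine Finset.sum_congr rfl fun y _ => ?_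
  have h : (∀ i : Fin n, i.val < max k (m + 2) → y i = 0) ↔
      (∀ i : Fin n, i.val < k → y i = 0) ∧ ∀ i : Fin n, i.val < m + 2 → y i = 0 := by
    simp only [lt_max_iff, or_imp, forall_and]
  by_cases h1 : ∀ i : Fin n, i.val < k → y i = 0
  · rw [if_pos h1, if_pos h1, meanOverlap_succ hm, if_congr (h.trans (and_iff_right h1)) rfl rfl]
  · rw [if_neg h1, if_neg h1, if_neg fun h2 => h1 (h.mp h2).1, add_zero, mul_zero]

theorem natCast_sq_sub_add_one_ne_zero (q : ℕ) : (q : ℂ) ^ 2 - q + 1 ≠ 0 := by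
  intro h
  have h' : (q : ℝ) ^ 2 - q + 1 = 0 := by exact_mod_cast h
  nlinarith [sq_nonneg ((q : ℝ) - 1 / 2)]

theorem natCast_sq_add_one_ne_zero (q : ℕ) : (q : ℂ) ^ 2 + 1 ≠ 0 := by
  exact_mod_cast Nat.succ_ne_zero (q ^ 2)

/-- Here the source is the constant `q ^ (n - k)`. In that unit the fixed point is `q / (q² - q +
1)`, and the initial deviation `(q - 1)² / (q² - q + 1)` shrinks by `q / (q² + 1)` per step. -/
theorem sumMeanOverlap_of_lt [NeZero q] {k m : ℕ} (hk : k ≤ n) (hm : m + 1 ≤ k) :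
    sumMeanOverlap n q k m = (q : ℂ) ^ (n - k) *
      ((q + ((q : ℂ) / ((q : ℂ) ^ 2 + 1)) ^ m * ((q : ℂ) - 1) ^ 2) / ((q : ℂ) ^ 2 - q + 1)) := by
  have hD := natCast_sq_sub_add_one_ne_zero q
  have hE := natCast_sq_add_one_ne_zero q
  induction m with
  | zero =>
    rw [sumMeanOverlap_zero hk, pow_zero, one_mul]
    rw [show (q : ℂ) + ((q : ℂ) - 1) ^ 2 = (q : ℂ) ^ 2 - q + 1 by ring, div_self hD, mul_one]
  | succ m ih =>
    rw [sumMeanOverlap_succ hk (by omega), ih (by omega), max_eq_left (by omega),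
      pow_succ ((q : ℂ) / ((q : ℂ) ^ 2 + 1))]
    generalize ((q : ℂ) / ((q : ℂ) ^ 2 + 1)) ^ m = c
    generalize hD' : (q : ℂ) ^ 2 - q + 1 = D at *
    field_simp
    rw [← hD']
    ring

/-- The source now loses a factor `q` per step. Dividing by `q ^ (n - (m + 1))` at step `m` turns
the recurrence into `T ↦ (q² T + q) / (q² + 1)`, with fixed point `q` and contraction rate `q² / (q²
+ 1)`; it starts at `m = k`, where the constant regime ends. -/
theorem sumMeanOverlap_add [NeZero q] {k d : ℕ} (hd : k + d + 1 ≤ n) :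
    sumMeanOverlap n q (k + 1) (k + d) = (q : ℂ) ^ (n - (k + d + 1)) *
      (q + ((q : ℂ) ^ 2 / ((q : ℂ) ^ 2 + 1)) ^ d *
        ((q + ((q : ℂ) / ((q : ℂ) ^ 2 + 1)) ^ k * ((q : ℂ) - 1) ^ 2) / ((q : ℂ) ^ 2 - q + 1) -
          q)) := by
  have hE := natCast_sq_add_one_ne_zero q
  induction d with
  | zero =>
    rw [show k + 0 = k from rfl, sumMeanOverlap_of_lt (by omega) le_rfl]
    ring
  | succ d ih =>
    rw [← Nat.add_assoc, sumMeanOverlap_succ (by omega) (by omega), ih (by omega),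
      max_eq_right (by omega), pow_succ ((q : ℂ) ^ 2 / ((q : ℂ) ^ 2 + 1)),
      show n - (k + d + 1) = n - (k + d + 2) + 1 by omega, pow_succ (q : ℂ)]
    generalize ((q : ℂ) ^ 2 / ((q : ℂ) ^ 2 + 1)) ^ d *
      ((q + ((q : ℂ) / ((q : ℂ) ^ 2 + 1)) ^ k * ((q : ℂ) - 1) ^ 2) / ((q : ℂ) ^ 2 - q + 1) -
          q) = z
    field_simp
    ring

end Average
end RewindingProtocol

theorem mainTheorem3 (q n k : ℕ) [NeZero q] (hn : 2 ≤ n) (hk : 1 ≤ k) (hkn : k ≤ n) :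
    MeasureTheory.Integrable
        (fun U => RewindingProtocol.convolutionalFidelity (n := n) (q := q) k U)
        (RewindingProtocol.gateMeasure n q) ∧
      RewindingProtocol.averagedFidelity n q k =
        ((1 - ((q : ℝ) ^ 2 / ((q : ℝ) ^ 2 + 1)) ^ (n - k) *
            (1 - 1 / ((q : ℝ) * ((q : ℝ) ^ 2 - (q : ℝ) + 1)) *
              (1 + ((q : ℝ) - 1) ^ 2 / (q : ℝ) *
                ((q : ℝ) / ((q : ℝ) ^ 2 + 1)) ^ ((k : ℤ) - 2))) : ℝ) : ℂ) := by
  refine ⟨RewindingProtocol.integrable_gateMeasure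
    (RewindingProtocol.continuous_convolutionalFidelity hn k), ?_⟩
  have hF : RewindingProtocol.averagedFidelity n q k =
      ((q : ℂ) ^ 2)⁻¹ * RewindingProtocol.sumMeanOverlap n q k (n - 2) :=
    RewindingProtocol.averagedFidelity_eq_sum hn k
  have hq : (q : ℂ) ≠ 0 := NeZero.ne _
  have hD := RewindingProtocol.natCast_sq_sub_add_one_ne_zero q
  have hE := RewindingProtocol.natCast_sq_add_one_ne_zero q
  rw [hF]
  push_cast
  -- For `k = n` the `n - 2` steps all lie in the constant regime.
  rcases hkn.eq_or_lt with rfl | hlt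
  · rw [RewindingProtocol.sumMeanOverlap_of_lt le_rfl (by omega),
      show ((k : ℤ) - 2) = ((k - 2 : ℕ) : ℤ) by omega, zpow_natCast, Nat.sub_self]
    generalize ((q : ℂ) / ((q : ℂ) ^ 2 + 1)) ^ (k - 2) = c
    generalize hD' : (q : ℂ) ^ 2 - q + 1 = D at *
    field_simp
    rw [← hD']
    ring
  -- The exponent `k - 2 = l - 1` may be `-1`, hence the integer power. The solution carries `d = n
  -- - k - 1` contraction factors; the missing one is absorbed through `q (q² - q + 1) - 1 = (q - 1)
  -- (q² + 1)`.
  · obtain ⟨l, rfl⟩ : ∃ l, k = l + 1 := ⟨k - 1, by omega⟩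
    obtain ⟨d, rfl⟩ : ∃ d, n = l + d + 2 := ⟨n - l - 2, by omega⟩
    rw [show l + d + 2 - 2 = l + d by omega, RewindingProtocol.sumMeanOverlap_add (by omega),
      show l + d + 2 - (l + d + 1) = 1 by omega, show l + d + 2 - (l + 1) = d + 1 by omega,
      show (((l + 1 : ℕ) : ℤ) - 2) = (l : ℤ) - 1 by push_cast; ring,
      zpow_sub_one₀ (div_ne_zero hq hE), zpow_natCast, pow_succ _ d]
    generalize ((q : ℂ) / ((q : ℂ) ^ 2 + 1)) ^ l = c
    generalize ((q : ℂ) ^ 2 / ((q : ℂ) ^ 2 + 1)) ^ d = e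
    generalize hD' : (q : ℂ) ^ 2 - q + 1 = D at *
    field_simp
    rw [← hD']
    ring
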